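/- For a linear subspace $E\subset M_{n}(\mathbb C)$ and $A\in M_n(\mathbb C)$ let $\mu_E(A)=1/\inf\{\|X\|: X\in E,\ \det(I-AX)=0\}$, with $\mu_E(A)=0$ if $I-AX$ is invertible for every $X\in E$; $\|\cdot\|$ is the operator norm. Let $E(3;3;1,1,1)\subset M_3(\mathbb C)$ be the space of diagonal matrices. Put $$\Gamma_{E(2;2;1,1)}=\{(a_{11},a_{22},\det A)\in\mathbb C^3: A\in M_2(\mathbb C),\ \|A\|\le 1\}$$ (the closed tetrablock) and let $\Gamma_{E(3;3;1,1,1)}\subset\mathbb C^7$ be the set of all points $$(a_{11},\ a_{22},\ a_{11}a_{22}-a_{12}a_{21},\ a_{33},\ a_{11}a_{33}-a_{13}a_{31},\ a_{22}a_{33}-a_{23}a_{32},\ \det A)$$ with $A\in M_3(\mathbb C)$ and $\mu_{E(3;3;1,1,1)}(A)\le 1$. Let $$b\Gamma_{E(2;2;1,1)}=\{x\in\Gamma_{E(2;2;1,1)}: x_1=\bar x_2x_3,\ |x_3|=1\}$$ (the distinguished boundary of the tetrablock) and $$K=\{x\in\Gamma_{E(3;3;1,1,1)}: x_1=\bar x_6x_7,\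 x_3=\bar x_4x_7,\ x_5=\bar x_2x_7,\ |x_7|=1\}.$$ A tetrablock unitary (respectively, a $\Gamma_{E(3;3;1,1,1)}$-unitary) is a commuting triple (respectively, $7$-tuple) of normal operators on a complex Hilbert space whose Taylor joint spectrum is contained in $b\Gamma_{E(2;2;1,1)}$ (respectively, in $K$). A tetrablock isometry (respectively, a $\Gamma_{E(3;3;1,1,1)}$-isometry) is a commuting triple (respectively, $7$-tuple) of bounded operators that is the restriction of a tetrablock unitary (respectively, a $\Gamma_{E(3;3;1,1,1)}$-unitary) to a joint invariant closed subspace. Then: (a) For all $x_1,x_6,x_7\in\mathbb C$, $(x_1,0,0,0,0,x_6,x_7)\in\Gamma_{E(3;3;1,1,1)}$ if and only if $(x_1,x_6,x_7)\in\Gamma_{E(2;2;1,1)}$. (b) Let $(T_1,T_6,T_7)$ be a commuting triple of bounded operators on a complex Hilbert space $\mathcal H$. Then $(T_1,T_6,T_7)$ is a tetrablock isometry if and only if $(T_1,0,0,0,0,T_6,T_7)$ is a $\Gamma_{E(3;3;1,1,1)}$-isometry. -/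

import Mathlib

universe u

noncomputable section

namespace Tetrablock

/-! Structured singular values and the sets in complex space -/

/-- The operator norm of a complex matrix acting on Euclidean space. -/
def opNorm {n : ℕ} (A : Matrix (Fin n) (Fin n) ℂ) : ℝ :=
  ‖Matrix.toEuclideanCLM (n := Fin n) (𝕜 := ℂ) A‖

open Classical in
/-- The structured singular value
`μ_E(A) = 1 / inf {‖X‖ : X ∈ E, det (1 - A X) = 0}`, which is `0` when no such `X` exists. -/
def mu {n : ℕ} (E : Submodule ℂ (Matrix (Fin n) (Fin n) ℂ)) (A : Matrix (Fin n) (Fin n) ℂ) : ℝ :=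
  if ∃ X ∈ E, (1 - A * X).det = 0 then
    1 / sInf {r : ℝ | ∃ X ∈ E, (1 - A * X).det = 0 ∧ r = opNorm X}
  else 0

/-- The space `E(3;3;1,1,1)` of matrices `diag [z₁, z₂, z₃]`. -/
def E333 : Submodule ℂ (Matrix (Fin 3) (Fin 3) ℂ) :=
  LinearMap.range (Matrix.diagonalLinearMap (Fin 3) ℂ ℂ)

/-- The closed tetrablock `Γ_{E(2;2;1,1)}`: the points `(a₁₁, a₂₂, det A)` with `‖A‖ ≤ 1`. -/
def Gamma2 : Set (Fin 3 → ℂ) :=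
  {x | ∃ A : Matrix (Fin 2) (Fin 2) ℂ, opNorm A ≤ 1 ∧ x = ![A 0 0, A 1 1, A.det]}

/-- The set `Γ_{E(3;3;1,1,1)}` in `ℂ⁷`; the coordinate `x_k` is `x (k - 1)`. -/
def Gamma3 : Set (Fin 7 → ℂ) :=
  {x | ∃ A : Matrix (Fin 3) (Fin 3) ℂ, mu E333 A ≤ 1 ∧
    x = ![A 0 0,
          A 1 1,
          A 0 0 * A 1 1 - A 0 1 * A 1 0,
          A 2 2,
          A 0 0 * A 2 2 - A 0 2 * A 2 0,
          A 1 1 * A 2 2 - A 1 2 * A 2 1,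
          A.det]}

/-- The distinguished boundary of the tetrablock: the points of the closed tetrablock with
`x₁ = conj x₂ * x₃` and `|x₃| = 1`. -/
def K2 : Set (Fin 3 → ℂ) :=
  {x | x ∈ Gamma2 ∧ x 0 = star (x 1) * x 2 ∧ ‖x 2‖ = 1}

/-- The set `K` of the points of `Γ_{E(3;3;1,1,1)}` with `x₁ = conj x₆ * x₇`,
`x₃ = conj x₄ * x₇`, `x₅ = conj x₂ * x₇` and `|x₇| = 1`. -/
def K3 : Set (Fin 7 → ℂ) :=
  {x | x ∈ Gamma3 ∧ x 0 = star (x 5) * x 6 ∧ x 2 = star (x 3) * x 6 ∧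
    x 4 = star (x 1) * x 6 ∧ ‖x 6‖ = 1}

/-! The Taylor joint spectrum -/

section Spectrum

variable {H : Type u} [NormedAddCommGroup H] [InnerProductSpace ℂ H] {n : ℕ}

/-- The differential of the Koszul complex of `T = (T₁, …, Tₙ)`. An element of `H ⊗ Λ(ℂⁿ)` is
written as a family `x` of vectors indexed by the subsets of `{1, …, n}`, standing for
`∑_S x_S ⊗ e_S`, where `e_S` is the increasing wedge product of the basis vectors in `S`; the
differential is `x ⊗ ω ↦ ∑ᵢ Tᵢ x ⊗ (eᵢ ∧ ω)`. -/
def koszulD (T : Fin n → H →L[ℂ] H) : (Finset (Fin n) → H) →ₗ[ℂ] (Finset (Fin n) → H) where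
  toFun x := fun S => ∑ i ∈ S, (-1 : ℂ) ^ (S.filter (· < i)).card • T i (x (S.erase i))
  map_add' x y := by
    funext S
    simp [Finset.sum_add_distrib]
  map_smul' c x := by
    funext S
    simp only [Pi.smul_apply, map_smul, RingHom.id_apply, Finset.smul_sum]
    exact Finset.sum_congr rfl fun i _ => smul_comm _ _ _

/-- The Taylor joint spectrum of a commuting tuple: the points `z` for which the Koszul complex of
`(T₁ - z₁, …, Tₙ - zₙ)` is not exact. The differential raises the degree (the number of elements of
`S`) by one, so exactness of the total complex is exactness in every degree. -/
def taylorSpectrum (T : Fin n → H →L[ℂ] H) : Set (Fin n → ℂ) :=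
  {z | ¬ Function.Exact (koszulD fun i => T i - z i • ContinuousLinearMap.id ℂ H)
      (koszulD fun i => T i - z i • ContinuousLinearMap.id ℂ H)}

end Spectrum

/-! Unitaries and isometries -/

/-- A commuting tuple of normal operators whose Taylor joint spectrum lies in `S`. -/
structure IsNormalTupleOn {n : ℕ} (S : Set (Fin n → ℂ)) {K : Type u} [NormedAddCommGroup K]
    [InnerProductSpace ℂ K] [CompleteSpace K] (N : Fin n → K →L[ℂ] K) : Prop where
  commute : ∀ i j, Commute (N i) (N j)
  normal : ∀ i, IsStarNormal (N i)
  spectrum_subset : taylorSpectrum N ⊆ S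

/-- Tetrablock unitaries. -/
def IsTetrablockUnitary {K : Type u} [NormedAddCommGroup K] [InnerProductSpace ℂ K]
    [CompleteSpace K] (N : Fin 3 → K →L[ℂ] K) : Prop :=
  IsNormalTupleOn K2 N

/-- `Γ_{E(3;3;1,1,1)}`-unitaries. -/
def IsGamma3Unitary {K : Type u} [NormedAddCommGroup K] [InnerProductSpace ℂ K]
    [CompleteSpace K] (N : Fin 7 → K →L[ℂ] K) : Prop :=
  IsNormalTupleOn K3 N

/-- Tetrablock isometries: commuting triples of bounded operators on `H` that are the restriction
of a tetrablock unitary, on some Hilbert space `K`, to a joint invariant subspace (the image of `H`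
under a linear isometry `J`). -/
def IsTetrablockIsometry {H : Type u} [NormedAddCommGroup H] [InnerProductSpace ℂ H]
    (T : Fin 3 → H →L[ℂ] H) : Prop :=
  (∀ i j, Commute (T i) (T j)) ∧
  ∃ (K : Type u) (_ : NormedAddCommGroup K) (_ : InnerProductSpace ℂ K) (_ : CompleteSpace K)
    (N : Fin 3 → K →L[ℂ] K) (J : H →ₗᵢ[ℂ] K),
    IsTetrablockUnitary N ∧ ∀ i h, N i (J h) = J (T i h)

/-- `Γ_{E(3;3;1,1,1)}`-isometries: commuting 7-tuples of bounded operators on `H` that are the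
restriction of a `Γ_{E(3;3;1,1,1)}`-unitary, on some Hilbert space `K`, to a joint invariant
subspace (the image of `H` under a linear isometry `J`). -/
def IsGamma3Isometry {H : Type u} [NormedAddCommGroup H] [InnerProductSpace ℂ H]
    (T : Fin 7 → H →L[ℂ] H) : Prop :=
  (∀ i j, Commute (T i) (T j)) ∧
  ∃ (K : Type u) (_ : NormedAddCommGroup K) (_ : InnerProductSpace ℂ K) (_ : CompleteSpace K)
    (N : Fin 7 → K →L[ℂ] K) (J : H →ₗᵢ[ℂ] K),
    IsGamma3Unitary N ∧ ∀ i h, N i (J h) = J (T i h)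

end Tetrablock

end

/-!
**Membership.** The principal minors of a `3 × 3` matrix `A` are the coefficients of
`det (1 - A diag(z₁, z₂, z₃))`, so `μ(A) ≤ 1` says that this polynomial has no zero in the open
tridisc (`mu_E333_le_one_iff`). At the point `(x₁, 0, 0, 0, 0, x₆, x₇)` the polynomial is
`1 - x₁ z₁ + x₆ z₂ z₃ - x₇ z₁ z₂ z₃`, which with `w = -z₂ z₃` becomes
`1 - x₁ z₁ - x₆ w + x₇ z₁ w`, and `w` runs through the whole disc. It remains to see that the closed
tetrablock is the set of points whose polynomial has no zero in the bidisc (`mem_Gamma2_iff`).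
Solving for either variable turns nonvanishing into two inequalities, which together are equivalent
to contractivity of the symmetric `2 × 2` matrix with diagonal `x₁, x₂` and determinant `x₃`.

**Isometries.** For commuting normal operators, which by Fuglede's theorem lie in a closed
commutative star subalgebra `B`, the Taylor joint spectrum is the set of joint values of the
characters of `B` (`mem_taylorSpectrum_iff`). If `∑ᵢ (Nᵢ - zᵢ) (Nᵢ - zᵢ)*` is invertible, its inverse
gives a contracting homotopy of the Koszul complex; conversely, exactness in the top degree makes the
row `(N₁ - z₁, …, Nₙ - zₙ)` onto, and then this sum is invertible. By Gelfand theory it fails to be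
invertible exactly when a character vanishes on all `Nᵢ - zᵢ`. Consequently, padding a tuple with
zero operators pads its joint spectrum with zeros, and passing to a subtuple projects the joint
spectrum.

Padding with zeros carries the distinguished boundary of the tetrablock into `K`, by the first part.
The coordinates `x₁, x₆, x₇` of an arbitrary point of `K` lie in the distinguished boundary of the
tetrablock (`mem_K2_of_mem_K3`). So unitaries pass to unitaries in both directions on the same space,
with the same embedded copy of `H`.
-/

open Function

namespace Tetrablock

/-! ### Exactness of Koszul complexes -/

section Koszul

variable {H : Type u} [NormedAddCommGroup H] [InnerProductSpace ℂ H] {n : ℕ}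

/-- The sign of `i` relative to `S`: the parity of the number of elements of `S` below `i`. -/
def koszulSign (S : Finset (Fin n)) (i : Fin n) : ℂ :=
  (-1) ^ (S.filter (· < i)).card

lemma koszulD_apply (A : Fin n → H →L[ℂ] H) (x : Finset (Fin n) → H) (S : Finset (Fin n)) :
    koszulD A x S = ∑ i ∈ S, koszulSign S i • A i (x (S.erase i)) := rfl

lemma koszulSign_mul_self (S : Finset (Fin n)) (i : Fin n) :
    koszulSign S i * koszulSign S i = 1 := by
  rw [koszulSign, ← mul_pow]; simp

lemma koszulSign_insert {S : Finset (Fin n)} {i j : Fin n} (hj : j ∉ S) :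
    koszulSign (insert j S) i = if j < i then -koszulSign S i else koszulSign S i := by
  unfold koszulSign
  rw [Finset.filter_insert]
  split_ifs
  · rw [Finset.card_insert_of_notMem (by simp [hj]), pow_succ]; ring
  · rfl

lemma koszulSign_erase {S : Finset (Fin n)} {i j : Fin n} (hj : j ∈ S) :
    koszulSign (S.erase j) i = if j < i then -koszulSign S i else koszulSign S i := by
  have h := koszulSign_insert (i := i) (Finset.notMem_erase j S)
  rw [Finset.insert_erase hj] at h
  split_ifs at h ⊢ <;> simp [h]

/-- As the `Aᵢ` commute and wedging with `eᵢ` anticommutes with wedging with `eⱼ`, the double sum is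
antisymmetric in `i` and `j`. -/
lemma koszulD_koszulD {A : Fin n → H →L[ℂ] H} (hA : ∀ i j, Commute (A i) (A j))
    (x : Finset (Fin n) → H) : koszulD A (koszulD A x) = 0 := by
  funext S
  let f : Fin n → Fin n → H := fun i j =>
    if i ∈ S ∧ j ∈ S ∧ j ≠ i then
      (koszulSign S i * koszulSign (S.erase i) j) • A i (A j (x ((S.erase i).erase j))) else 0
  have hf : koszulD A (koszulD A x) S = ∑ i, ∑ j, f i j := by
    rw [koszulD_apply, ← Finset.sum_subset S.subset_univ]
    · refine Finset.sum_congr rfl fun i hi => ?_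
      rw [koszulD_apply, map_sum, Finset.smul_sum, ← Finset.sum_subset (S.erase i).subset_univ]
      · refine Finset.sum_congr rfl fun j hj => ?_
        rw [Finset.mem_erase] at hj
        simp [f, hi, hj, mul_smul]
      · intro j _ hj
        rw [Finset.mem_erase] at hj
        exact if_neg fun h => hj ⟨h.2.2, h.2.1⟩
    · intro i _ hi
      simp [f, hi]
  have hanti : ∀ i j, f i j = -f j i := by
    intro i j
    by_cases h : i ∈ S ∧ j ∈ S ∧ j ≠ i
    · obtain ⟨hi, hj, hij⟩ := h
      have hc : A j (A i (x ((S.erase i).erase j))) = A i (A j (x ((S.erase i).erase j))) :=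
        DFunLike.congr_fun (hA j i) _
      simp only [f, hi, hj, hij, hij.symm, ne_eq, not_false_eq_true, and_self, if_true]
      rw [Finset.erase_right_comm (a := j) (b := i), hc, koszulSign_erase hi, koszulSign_erase hj,
        ← neg_smul]
      congr 1
      rcases lt_or_gt_of_ne hij with h | h
      · simp [h, h.not_gt]; ring
      · simp [h, h.not_gt]; ring
    · have h' : ¬ (j ∈ S ∧ i ∈ S ∧ i ≠ j) := fun h' => h ⟨h'.2.1, h'.1, h'.2.2.symm⟩
      simp only [f, if_neg h, if_neg h', neg_zero]
  have hself : ∑ i, ∑ j, f i j = -∑ i, ∑ j, f i j := by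
    conv_lhs => rw [Finset.sum_comm]
    rw [← Finset.sum_neg_distrib]
    refine Finset.sum_congr rfl fun i _ => ?_
    rw [← Finset.sum_neg_distrib]
    exact Finset.sum_congr rfl fun j _ => hanti j i
  rw [hf, Pi.zero_apply]
  have h2 : (2 : ℂ) • ∑ i, ∑ j, f i j = 0 := by
    rw [two_smul, add_eq_zero_iff_eq_neg]
    exact hself
  exact (smul_eq_zero.1 h2).resolve_left two_ne_zero

/-- The contraction `x ⊗ ω ↦ ∑ᵢ Cᵢ x ⊗ (eᵢ* ⌟ ω)`. -/
def koszulH (C : Fin n → H →L[ℂ] H) (x : Finset (Fin n) → H) : Finset (Fin n) → H :=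
  fun S => ∑ j ∈ Sᶜ, koszulSign S j • C j (x (insert j S))

/-- If `∑ᵢ Cᵢ Aᵢ = 1` and the `Cᵢ` commute with the `Aᵢ`, then contraction against `C` is a
contracting homotopy of the Koszul complex of `A`. -/
lemma koszul_homotopy {A C : Fin n → H →L[ℂ] H} (hAC : ∀ i j, Commute (A i) (C j))
    (h1 : ∑ i, C i * A i = 1) (x : Finset (Fin n) → H) :
    koszulD A (koszulH C x) + koszulH C (koszulD A x) = x := by
  have h0 : ∀ y, koszulH C y = fun S => ∑ j ∈ Sᶜ, koszulSign S j • C j (y (insert j S)) :=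
    fun _ => rfl
  funext S
  have hD : koszulD A (koszulH C x) S = ∑ i ∈ S, (C i (A i (x S)) +
      ∑ j ∈ Sᶜ, (koszulSign S i * koszulSign (S.erase i) j) •
        C j (A i (x ((insert j S).erase i)))) := by
    rw [koszulD_apply]
    refine Finset.sum_congr rfl fun i hi => ?_
    have hii : koszulSign (S.erase i) i = koszulSign S i := by simp [koszulSign_erase hi]
    have hcomm : ∀ j y, A i (C j y) = C j (A i y) := fun j y => DFunLike.congr_fun (hAC i j) y
    rw [h0]
    simp only []
    rw [Finset.compl_erase, Finset.sum_insert (by simpa using hi), map_add, smul_add, map_smul,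
      smul_smul, hii, koszulSign_mul_self, one_smul, Finset.insert_erase hi, hcomm]
    congr 1
    rw [map_sum, Finset.smul_sum]
    refine Finset.sum_congr rfl fun j hj => ?_
    have hij : j ≠ i := by rintro rfl; exact Finset.mem_compl.1 hj hi
    rw [map_smul, smul_smul, hcomm, Finset.erase_insert_of_ne hij]
  have hH : koszulH C (koszulD A x) S = ∑ j ∈ Sᶜ, (C j (A j (x S)) +
      ∑ i ∈ S, (koszulSign S j * koszulSign (insert j S) i) •
        C j (A i (x ((insert j S).erase i)))) := by
    rw [h0]
    refine Finset.sum_congr rfl fun j hj => ?_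
    rw [Finset.mem_compl] at hj
    have hjj : koszulSign (insert j S) j = koszulSign S j := by simp [koszulSign_insert hj]
    rw [koszulD_apply, Finset.sum_insert hj, map_add, smul_add, map_smul, smul_smul, hjj,
      koszulSign_mul_self, one_smul, Finset.erase_insert hj, map_sum, Finset.smul_sum]
    congr 1
    refine Finset.sum_congr rfl fun i _ => ?_
    rw [map_smul, smul_smul]
  have hcancel : (∑ i ∈ S, ∑ j ∈ Sᶜ, (koszulSign S i * koszulSign (S.erase i) j) •
        C j (A i (x ((insert j S).erase i)))) +
      ∑ j ∈ Sᶜ, ∑ i ∈ S, (koszulSign S j * koszulSign (insert j S) i) •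
        C j (A i (x ((insert j S).erase i))) = 0 := by
    conv_lhs => enter [2]; rw [Finset.sum_comm]
    rw [← Finset.sum_add_distrib]
    refine Finset.sum_eq_zero fun i hi => ?_
    rw [← Finset.sum_add_distrib]
    refine Finset.sum_eq_zero fun j hj => ?_
    rw [Finset.mem_compl] at hj
    have hij : i ≠ j := by rintro rfl; exact hj hi
    rw [← add_smul, koszulSign_erase hi, koszulSign_insert hj]
    convert zero_smul ℂ _
    rcases lt_or_gt_of_ne hij with h | h
    · simp [h, h.not_gt]; ring
    · simp [h, h.not_gt]; ring
  have hdiag : (∑ i ∈ S, C i (A i (x S))) + ∑ j ∈ Sᶜ, C j (A j (x S)) = x S := by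
    rw [Finset.sum_add_sum_compl]
    simpa using DFunLike.congr_fun h1 (x S)
  rw [Pi.add_apply, hD, hH, Finset.sum_add_distrib, Finset.sum_add_distrib, add_add_add_comm,
    hcancel, hdiag, add_zero]

lemma koszulH_zero (C : Fin n → H →L[ℂ] H) : koszulH C 0 = 0 := by
  funext S
  simp [koszulH]

lemma koszul_exact_of_sum_mul_eq_one {A C : Fin n → H →L[ℂ] H} (hA : ∀ i j, Commute (A i) (A j))
    (hAC : ∀ i j, Commute (A i) (C j)) (h1 : ∑ i, C i * A i = 1) :
    Exact (koszulD A) (koszulD A) := by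
  intro x
  constructor
  · intro hx
    refine ⟨koszulH C x, ?_⟩
    simpa [hx, koszulH_zero] using koszul_homotopy hAC h1 x
  · rintro ⟨y, rfl⟩
    exact koszulD_koszulD hA y

/-- Exactness in the top degree. -/
lemma exists_sum_eq_of_koszul_exact {A : Fin n → H →L[ℂ] H} (h : Exact (koszulD A) (koszulD A))
    (v : H) : ∃ y : Fin n → H, ∑ i, A i (y i) = v := by
  have htop : koszulD A (Pi.single Finset.univ v) = 0 := by
    funext S
    rw [koszulD_apply]
    refine Finset.sum_eq_zero fun i _ => ?_
    have hne : S.erase i ≠ Finset.univ := fun h => Finset.notMem_erase i S (h ▸ Finset.mem_univ i)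
    rw [Pi.single_eq_of_ne hne, map_zero, smul_zero]
  obtain ⟨x, hx⟩ := (h _).1 htop
  refine ⟨fun i => koszulSign Finset.univ i • x (Finset.univ.erase i), ?_⟩
  simpa [koszulD_apply] using congrFun hx Finset.univ

end Koszul

/-! ### The Taylor spectrum of commuting normal operators -/

section NormalTuple

variable {K : Type u} [NormedAddCommGroup K] [InnerProductSpace ℂ K] [CompleteSpace K] {n : ℕ}

/-- If the row operator `(A₁, …, Aₙ)` is onto, then by the open mapping theorem its adjoint is
bounded below, so `∑ᵢ Aᵢ Aᵢ*` is invertible. -/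
lemma isUnit_sum_mul_star {A : Fin n → K →L[ℂ] K} (h : ∀ v, ∃ y : Fin n → K, ∑ i, A i (y i) = v) :
    IsUnit (∑ i, A i * star (A i)) := by
  let R : (Fin n → K) →L[ℂ] K := ∑ i, (A i).comp (ContinuousLinearMap.proj i)
  have hR : ∀ y, R y = ∑ i, A i (y i) := fun y => by simp [R]
  obtain ⟨C, hC, hpre⟩ := R.exists_preimage_norm_le fun v => by simpa only [hR] using h v
  have hinner : ∀ v, inner ℂ ((∑ i, A i * star (A i)) v) v = ((∑ i, ‖star (A i) v‖ ^ 2 : ℝ) : ℂ) := by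
    intro v
    simp only [_root_.sum_apply, sum_inner, Complex.ofReal_sum]
    refine Finset.sum_congr rfl fun i _ => ?_
    rw [mul_apply_eq_comp, ← ContinuousLinearMap.adjoint_inner_right,
      ← ContinuousLinearMap.star_eq_adjoint, inner_self_eq_norm_sq_to_K]
    simp
  have hbound : ∀ v, ‖v‖ ^ 2 ≤ C ^ 2 * n * ∑ i, ‖star (A i) v‖ ^ 2 := by
    intro v
    obtain ⟨y, hy, hyC⟩ := hpre v
    rw [hR] at hy
    have h1 : ‖v‖ ^ 2 ≤ (∑ i, ‖star (A i) v‖) * (C * ‖v‖) := by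
      have h2 : ((‖v‖ ^ 2 : ℝ) : ℂ) = ∑ i, inner ℂ (y i) (star (A i) v) := by
        rw [Complex.ofReal_pow]
        refine (inner_self_eq_norm_sq_to_K (𝕜 := ℂ) v).symm.trans ?_
        conv_lhs => enter [2]; rw [← hy]
        rw [sum_inner]
        refine Finset.sum_congr rfl fun i _ => ?_
        rw [ContinuousLinearMap.star_eq_adjoint, ContinuousLinearMap.adjoint_inner_right]
      have h3 : ‖v‖ ^ 2 = ‖∑ i, inner ℂ (y i) (star (A i) v)‖ := by
        rw [← h2, Complex.norm_real, Real.norm_of_nonneg (by positivity)]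
      rw [h3, Finset.sum_mul]
      refine (norm_sum_le _ _).trans (Finset.sum_le_sum fun i _ => ?_)
      refine (norm_inner_le_norm _ _).trans ?_
      rw [mul_comm]
      gcongr
      exact (norm_le_pi_norm y i).trans hyC
    have h4 : (∑ i, ‖star (A i) v‖) ^ 2 ≤ n * ∑ i, ‖star (A i) v‖ ^ 2 := by
      simpa using sq_sum_le_card_mul_sum_sq (s := Finset.univ) (f := fun i => ‖star (A i) v‖)
    rcases eq_or_lt_of_le (norm_nonneg v) with hv | hv
    · rw [← hv, zero_pow two_ne_zero]
      exact mul_nonneg (by positivity) (Finset.sum_nonneg fun i _ => by positivity)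
    · have h5 : ‖v‖ ≤ C * ∑ i, ‖star (A i) v‖ := by
        have : ‖v‖ * ‖v‖ ≤ (C * ∑ i, ‖star (A i) v‖) * ‖v‖ := by linarith
        exact le_of_mul_le_mul_right this hv
      calc ‖v‖ ^ 2 ≤ (C * ∑ i, ‖star (A i) v‖) ^ 2 := by gcongr
        _ = C ^ 2 * (∑ i, ‖star (A i) v‖) ^ 2 := by ring
        _ ≤ C ^ 2 * (n * ∑ i, ‖star (A i) v‖ ^ 2) := by gcongr
        _ = _ := by ring
  -- The added `1` keeps the constant positive when `n = 0`.
  have hc : 0 < (C ^ 2 * n + 1)⁻¹ := by positivity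
  refine ContinuousLinearMap.isUnit_of_forall_le_norm_inner_map _
    (c := ⟨(C ^ 2 * n + 1)⁻¹, hc.le⟩) hc fun v => ?_
  have hnn : 0 ≤ ∑ i, ‖star (A i) v‖ ^ 2 := by positivity
  rw [hinner, Complex.norm_real, Real.norm_of_nonneg hnn]
  change ‖v‖ ^ 2 * (C ^ 2 * n + 1)⁻¹ ≤ _
  rw [← div_eq_mul_inv, div_le_iff₀ (by positivity)]
  linarith [hbound v]

/-- For a tuple in a closed commutative star subalgebra `B` of `B(K)` (so a tuple of commuting
normal operators), the Taylor joint spectrum is the set of values of the characters of `B` at the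
tuple. Both conditions on `z` say that `∑ᵢ (Nᵢ - zᵢ) (Nᵢ - zᵢ)*` is not invertible. -/
theorem mem_taylorSpectrum_iff {N : Fin n → K →L[ℂ] K} (B : StarSubalgebra ℂ (K →L[ℂ] K))
    (hB : IsClosed (B : Set (K →L[ℂ] K))) (hcomm : ∀ x ∈ B, ∀ y ∈ B, x * y = y * x)
    (hN : ∀ i, N i ∈ B) (z : Fin n → ℂ) :
    z ∈ taylorSpectrum N ↔ ∃ χ : B →⋆ₐ[ℂ] ℂ, ∀ i, χ ⟨N i, hN i⟩ = z i := by
  let _ : CommCStarAlgebra B :=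
    { (inferInstance : CStarAlgebra B) with
      mul_comm := fun x y => Subtype.ext (hcomm x x.2 y y.2) }
  let a : Fin n → B := fun i => ⟨N i, hN i⟩ - algebraMap ℂ B (z i)
  have hA : ∀ i, N i - z i • ContinuousLinearMap.id ℂ K = a i := by
    intro i
    rfl
  let s : B := ∑ i, a i * star (a i)
  have hs : (s : K →L[ℂ] K) = ∑ i, (a i : K →L[ℂ] K) * star (a i : K →L[ℂ] K) := by
    simp [s]
  have hχ : ∀ χ : B →⋆ₐ[ℂ] ℂ, χ s = ((∑ i, ‖χ ⟨N i, hN i⟩ - z i‖ ^ 2 : ℝ) : ℂ) := by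
    intro χ
    simp only [s, map_sum, Complex.ofReal_sum]
    refine Finset.sum_congr rfl fun i _ => ?_
    have hai : χ (a i) = χ ⟨N i, hN i⟩ - z i := by
      simp only [a, map_sub, AlgHomClass.commutes]
      rfl
    rw [map_mul, map_star, hai]
    exact (Complex.mul_conj' _).trans (by push_cast; rfl)
  simp only [taylorSpectrum, Set.mem_ofPred_eq, hA]
  constructor
  · contrapose!
    intro hno
    have hu : IsUnit s := by
      by_contra hu
      obtain ⟨f, hf⟩ := WeakDual.CharacterSpace.exists_apply_eq_zero hu
      let χ : B →⋆ₐ[ℂ] ℂ :=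
        { WeakDual.CharacterSpace.toAlgHom f with map_star' := fun x => map_star f x }
      have h0 : ∑ i, ‖χ ⟨N i, hN i⟩ - z i‖ ^ 2 = 0 := by
        have := (hχ χ).symm.trans hf
        exact_mod_cast this
      obtain ⟨i, hi⟩ := hno χ
      rw [Finset.sum_eq_zero_iff_of_nonneg (fun _ _ => by positivity)] at h0
      exact hi (sub_eq_zero.1 (by simpa using h0 i (Finset.mem_univ i)))
    obtain ⟨t, ht⟩ := hu.exists_left_inv
    refine koszul_exact_of_sum_mul_eq_one (C := fun i => ((t * star (a i) : B) : K →L[ℂ] K))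
      (fun i j => hcomm _ (a i).2 _ (a j).2) (fun i j => hcomm _ (a i).2 _ (t * star (a j)).2) ?_
    have h1 : ∑ i, (t * star (a i)) * a i = 1 := by
      rw [← ht, Finset.mul_sum]
      exact Finset.sum_congr rfl fun i _ => by ring
    simpa using congrArg (Subtype.val : B → K →L[ℂ] K) h1
  · rintro ⟨χ, hχz⟩ hex
    have hu := isUnit_sum_mul_star (exists_sum_eq_of_koszul_exact hex)
    rw [← hs] at hu
    have := hB
    have hu' : IsUnit (χ s) := ((StarSubalgebra.coe_isUnit B).1 hu).map χ
    rw [hχ] at hu'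
    simp [hχz] at hu'

/-- Commuting normal operators lie in a closed commutative star subalgebra, by Fuglede's theorem. -/
lemma exists_comm_starSubalgebra {N : Fin n → K →L[ℂ] K} (hc : ∀ i j, Commute (N i) (N j))
    (hn : ∀ i, IsStarNormal (N i)) :
    ∃ B : StarSubalgebra ℂ (K →L[ℂ] K), IsClosed (B : Set (K →L[ℂ] K)) ∧
      (∀ x ∈ B, ∀ y ∈ B, x * y = y * x) ∧ ∀ i, N i ∈ B := by
  have hstar : ∀ i j, Commute (N i) (star (N j)) := fun i j =>
    (hn j).commute_star_right (hc i j)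
  have hset : ∀ a ∈ Set.range N ∪ star (Set.range N), ∀ b ∈ Set.range N ∪ star (Set.range N),
      a * b = b * a := by
    rintro a (⟨i, rfl⟩ | ⟨i, hi⟩) b (⟨j, rfl⟩ | ⟨j, hj⟩)
    · exact hc i j
    · rw [← star_star b, ← hj]
      exact hstar i j
    · rw [← star_star a, ← hi]
      exact (hstar j i).symm
    · rw [← star_star a, ← star_star b, ← hi, ← hj]
      exact (hc i j).star_star
  refine ⟨StarSubalgebra.centralizer ℂ (StarSubalgebra.centralizer ℂ (Set.range N) : Set _),
    Set.isClosed_centralizer _, ?_, fun i => ?_⟩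
  · intro x hx y hy
    rw [← SetLike.mem_coe, StarSubalgebra.coe_centralizer_centralizer] at hx hy
    exact Set.centralizer_centralizer_comm_of_comm hset _ hx _ hy
  · rw [← SetLike.mem_coe, StarSubalgebra.coe_centralizer_centralizer]
    exact Set.subset_centralizer_centralizer (Or.inl ⟨i, rfl⟩)

end NormalTuple

/-! ### The closed tetrablock -/

lemma opNorm_diagonal {n : ℕ} (z : Fin n → ℂ) : opNorm (Matrix.diagonal z) = ‖z‖ := by
  open scoped Matrix.Norms.L2Operator in
  exact Matrix.l2_opNorm_diagonal z

lemma det_one_sub_mul_ne_zero {n : ℕ} {A X : Matrix (Fin n) (Fin n) ℂ} (hA : opNorm A ≤ 1)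
    (hX : opNorm X < 1) : (1 - A * X).det ≠ 0 := by
  have hlt : ‖Matrix.toEuclideanCLM (n := Fin n) (𝕜 := ℂ) (A * X)‖ < 1 := by
    rw [map_mul]
    refine (norm_mul_le _ _).trans_lt ?_
    change opNorm A * opNorm X < 1
    exact (mul_le_of_le_one_left (norm_nonneg _) hA).trans_lt hX
  have hu := isUnit_one_sub_of_norm_lt_one hlt
  rw [← map_one (Matrix.toEuclideanCLM (n := Fin n) (𝕜 := ℂ)), ← map_sub] at hu
  have hu' : IsUnit (1 - A * X) := (MulEquiv.isUnit_map _).1 hu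
  exact ((Matrix.isUnit_iff_isUnit_det _).1 hu').ne_zero

/-- The polynomial `1 - x₁ z - x₂ w + x₃ z w` has no zero in the open bidisc. -/
def NonvanishingOnBidisc (x₁ x₂ x₃ : ℂ) : Prop :=
  ∀ z w : ℂ, ‖z‖ < 1 → ‖w‖ < 1 → 1 - x₁ * z - x₂ * w + x₃ * z * w ≠ 0

lemma NonvanishingOnBidisc.symm {x₁ x₂ x₃ : ℂ} (h : NonvanishingOnBidisc x₁ x₂ x₃) :
    NonvanishingOnBidisc x₂ x₁ x₃ := fun z w hz hw h0 =>
  h w z hw hz (by rw [← h0]; ring)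

lemma nonvanishingOnBidisc_of_mem_Gamma2 {x₁ x₂ x₃ : ℂ} (h : ![x₁, x₂, x₃] ∈ Gamma2) :
    NonvanishingOnBidisc x₁ x₂ x₃ := by
  obtain ⟨A, hA, hx⟩ := h
  intro z w hz hw
  have h0 : x₁ = A 0 0 := congrFun hx 0
  have h1 : x₂ = A 1 1 := congrFun hx 1
  have h2 : x₃ = A.det := congrFun hx 2
  have hX : opNorm (Matrix.diagonal ![z, w]) < 1 := by
    rw [opNorm_diagonal, pi_norm_lt_iff one_pos, Fin.forall_fin_two]
    exact ⟨hz, hw⟩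
  have := det_one_sub_mul_ne_zero hA hX
  rw [Matrix.det_fin_two] at this
  simp only [Matrix.sub_apply, Matrix.mul_diagonal, Matrix.one_apply] at this
  simp at this
  rw [h0, h1, h2, Matrix.det_fin_two]
  convert this using 1
  ring

/-- Maximizing over `z`, nonvanishing on the bidisc says that the Möbius map
`w ↦ (x₁ - x₃ w) / (1 - x₂ w)` is bounded by one; the bound persists on the closed disc. -/
lemma NonvanishingOnBidisc.norm_le {x₁ x₂ x₃ : ℂ} (h : NonvanishingOnBidisc x₁ x₂ x₃) {w : ℂ}
    (hw : ‖w‖ ≤ 1) : ‖x₁ - x₃ * w‖ ≤ ‖1 - x₂ * w‖ := by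
  have hopen : ∀ w ∈ Metric.ball (0 : ℂ) 1, ‖x₁ - x₃ * w‖ ≤ ‖1 - x₂ * w‖ := by
    intro w hw
    by_contra! hlt
    have hne : x₁ - x₃ * w ≠ 0 := norm_pos_iff.1 ((norm_nonneg _).trans_lt hlt)
    refine h ((1 - x₂ * w) / (x₁ - x₃ * w)) w ?_ (by simpa using hw) ?_
    · rw [norm_div]
      exact (div_lt_one (norm_pos_iff.2 hne)).2 hlt
    · linear_combination -div_mul_cancel₀ (1 - x₂ * w) hne
  refine le_on_closure hopen (by fun_prop) (by fun_prop) ?_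
  rw [closure_ball _ one_ne_zero]
  simpa using hw

lemma exists_norm_eq_one_mul_eq_norm (e : ℂ) : ∃ w : ℂ, ‖w‖ = 1 ∧ w * e = ‖e‖ := by
  by_cases he : e = 0
  · exact ⟨1, by simp, by simp [he]⟩
  · have hn : (‖e‖ : ℂ) ≠ 0 := by simpa using he
    refine ⟨(starRingEnd ℂ) e / ‖e‖, ?_, ?_⟩
    · rw [norm_div, RCLike.norm_conj, Complex.norm_real, norm_norm]
      exact div_self (by simpa using he)
    · rw [div_mul_eq_mul_div, Complex.conj_mul', sq, mul_div_assoc, div_self hn, mul_one]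

lemma norm_sub_sq_complex (u v : ℂ) :
    ‖u - v‖ ^ 2 = ‖u‖ ^ 2 + ‖v‖ ^ 2 - 2 * (u * (starRingEnd ℂ) v).re := by
  simp only [← Complex.normSq_eq_norm_sq, Complex.normSq_sub]

/-- The bound of `NonvanishingOnBidisc.norm_le` at its extremal point of the unit circle. -/
lemma NonvanishingOnBidisc.two_mul_norm_le {x₁ x₂ x₃ : ℂ} (h : NonvanishingOnBidisc x₁ x₂ x₃) :
    2 * ‖x₂ - (starRingEnd ℂ) x₁ * x₃‖ ≤ 1 - ‖x₁‖ ^ 2 + ‖x₂‖ ^ 2 - ‖x₃‖ ^ 2 := by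
  obtain ⟨w, hw, hwe⟩ := exists_norm_eq_one_mul_eq_norm (x₂ - (starRingEnd ℂ) x₁ * x₃)
  have hle : ‖x₁ - x₃ * w‖ ^ 2 ≤ ‖1 - x₂ * w‖ ^ 2 := by
    have := h.norm_le hw.le
    gcongr
  rw [norm_sub_sq_complex, norm_sub_sq_complex, norm_mul, norm_mul, hw] at hle
  have hre : (x₂ * w).re - (x₁ * (starRingEnd ℂ) (x₃ * w)).re
      = ‖x₂ - (starRingEnd ℂ) x₁ * x₃‖ := by
    rw [← Complex.ofReal_re ‖x₂ - (starRingEnd ℂ) x₁ * x₃‖, ← hwe]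
    simp
    ring
  have h1 : ((1 : ℂ) * (starRingEnd ℂ) (x₂ * w)).re = (x₂ * w).re := by
    rw [one_mul, Complex.conj_re]
  rw [h1] at hle
  simp only [norm_one, mul_one, one_pow] at hle
  linarith

/-- The sign information needed to take square roots in the bound on `|x₁ x₂ - x₃|²`: here `p, q, r`
are the moduli of `x₁, x₂, x₃` and `t` is the real part of `x₁ x₂ conj x₃`. -/
lemma add_sq_le_of_sq_le {p q r t : ℝ} (hp : 0 ≤ p) (hr : 0 ≤ r) (hp1 : p ≤ 1)
    (hq1 : q ≤ 1) (ht : t ≤ p * q * r) (h1 : |p ^ 2 - q ^ 2| ≤ 1 - r ^ 2)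
    (hsq : 4 * (p ^ 2 * q ^ 2 + r ^ 2 - 2 * t) ≤ (1 - p ^ 2 - q ^ 2 + r ^ 2) ^ 2) :
    p ^ 2 + q ^ 2 ≤ 1 + r ^ 2 := by
  by_contra! hlt
  have hsq' : (2 * (p * q - r)) ^ 2 ≤ (p ^ 2 + q ^ 2 - 1 - r ^ 2) ^ 2 := by nlinarith
  obtain ⟨hlo, hhi⟩ := abs_le.1 (abs_le_of_sq_le_sq hsq' (by linarith))
  -- The two bounds say `(p - q)² ≥ (1 - r)²` and `(p + q)² ≥ (1 + r)²`, with one of them strict.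
  have hY : (1 - r) ^ 2 ≤ (p - q) ^ 2 := by nlinarith
  have hX : (1 + r) ^ 2 ≤ (p + q) ^ 2 := by nlinarith
  have hXY : (p + q) ^ 2 * (p - q) ^ 2 ≤ (1 + r) ^ 2 * (1 - r) ^ 2 := by
    have := sq_le_sq' (abs_le.1 h1).1 (abs_le.1 h1).2
    calc _ = (p ^ 2 - q ^ 2) ^ 2 := by ring
      _ ≤ (1 - r ^ 2) ^ 2 := this
      _ = _ := by ring
  have hr1 : r ^ 2 ≤ 1 := by linarith [abs_nonneg (p ^ 2 - q ^ 2)]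
  have hrlt : r < 1 := by
    by_contra! h
    nlinarith
  have hX0 : 0 < (1 + r) ^ 2 := by positivity
  have hY0 : 0 < (1 - r) ^ 2 := by have : 0 < 1 - r := by linarith
                                   positivity
  have hX' : (p + q) ^ 2 ≤ (1 + r) ^ 2 := by
    refine le_of_mul_le_mul_right (le_trans ?_ hXY) hY0
    gcongr
  have hY' : (p - q) ^ 2 ≤ (1 - r) ^ 2 := by
    refine le_of_mul_le_mul_left (le_trans ?_ hXY) hX0
    gcongr
  nlinarith

/-- The two bounds obtained by solving for `z` and for `w` give the bound on `|x₁ x₂ - x₃|` that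
makes the symmetric matrix with diagonal `x₁, x₂` and determinant `x₃` a contraction. -/
lemma NonvanishingOnBidisc.two_mul_norm_det_le {x₁ x₂ x₃ : ℂ}
    (h : NonvanishingOnBidisc x₁ x₂ x₃) :
    2 * ‖x₁ * x₂ - x₃‖ ≤ 1 - ‖x₁‖ ^ 2 - ‖x₂‖ ^ 2 + ‖x₃‖ ^ 2 := by
  have hI := h.two_mul_norm_le
  have hII := h.symm.two_mul_norm_le
  have hp1 : ‖x₁‖ ≤ 1 := by simpa using h.norm_le (w := 0) (by simp)
  have hq1 : ‖x₂‖ ≤ 1 := by simpa using h.symm.norm_le (w := 0) (by simp)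
  set t := (x₁ * x₂ * (starRingEnd ℂ) x₃).re with ht
  have he : ‖x₂ - (starRingEnd ℂ) x₁ * x₃‖ ^ 2
      = ‖x₂‖ ^ 2 + ‖x₁‖ ^ 2 * ‖x₃‖ ^ 2 - 2 * t := by
    rw [norm_sub_sq_complex, norm_mul, RCLike.norm_conj, mul_pow, ht, map_mul, Complex.conj_conj]
    ring_nf
  have hd : ‖x₁ * x₂ - x₃‖ ^ 2 = ‖x₁‖ ^ 2 * ‖x₂‖ ^ 2 + ‖x₃‖ ^ 2 - 2 * t := by
    rw [norm_sub_sq_complex, norm_mul, mul_pow]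
  have htle : t ≤ ‖x₁‖ * ‖x₂‖ * ‖x₃‖ := by
    refine (Complex.re_le_norm _).trans ?_
    rw [norm_mul, norm_mul, RCLike.norm_conj]
  have hn1 := norm_nonneg (x₂ - (starRingEnd ℂ) x₁ * x₃)
  have hn2 := norm_nonneg (x₁ - (starRingEnd ℂ) x₂ * x₃)
  have hsqI : (2 * ‖x₂ - (starRingEnd ℂ) x₁ * x₃‖) ^ 2
      ≤ (1 - ‖x₁‖ ^ 2 + ‖x₂‖ ^ 2 - ‖x₃‖ ^ 2) ^ 2 := by gcongr
  -- By `he` and `hd`, this bound differs from `hsqI` by `4 (1 - |x₁|²) (|x₂|² - |x₃|²)` on both sides.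
  have hsq : (2 * ‖x₁ * x₂ - x₃‖) ^ 2 ≤ (1 - ‖x₁‖ ^ 2 - ‖x₂‖ ^ 2 + ‖x₃‖ ^ 2) ^ 2 := by
    rw [mul_pow, hd]
    rw [mul_pow, he] at hsqI
    linarith
  have hsum := add_sq_le_of_sq_le (norm_nonneg x₁) (norm_nonneg x₃) hp1 hq1 htle
    (abs_le.2 ⟨by linarith, by linarith⟩) (by rw [mul_pow, hd] at hsq; linarith)
  exact abs_le_of_sq_le_sq' hsq (by linarith) |>.2

/-- The symmetric matrix with diagonal `x₁, x₂` and off-diagonal entries a square root of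
`x₁ x₂ - x₃` realizes the point `(x₁, x₂, x₃)`; the hypotheses say that it is a contraction. -/
lemma mem_Gamma2_of_le {x₁ x₂ x₃ : ℂ} (h1 : ‖x₁‖ ^ 2 + ‖x₁ * x₂ - x₃‖ ≤ 1)
    (h2 : ‖x₂‖ ^ 2 + ‖x₁ * x₂ - x₃‖ ≤ 1)
    (h3 : 2 * ‖x₁ * x₂ - x₃‖ ≤ 1 - ‖x₁‖ ^ 2 - ‖x₂‖ ^ 2 + ‖x₃‖ ^ 2) :
    ![x₁, x₂, x₃] ∈ Gamma2 := by
  obtain ⟨β, hβ⟩ := IsAlgClosed.exists_pow_nat_eq (x₁ * x₂ - x₃) (n := 2) two_pos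
  have hβn : ‖β‖ ^ 2 = ‖x₁ * x₂ - x₃‖ := by rw [← norm_pow, hβ]
  rw [← hβn] at h1 h2 h3
  refine ⟨!![x₁, β; β, x₂], ?_, ?_⟩
  swap
  · have : x₃ = x₁ * x₂ - β * β := by rw [← sq, hβ]; ring
    simp [Matrix.det_fin_two, this]
  set s := x₁ * (starRingEnd ℂ) β + β * (starRingEnd ℂ) x₂ with hs
  have hs2 : ‖s‖ ^ 2 ≤ (1 - ‖x₁‖ ^ 2 - ‖β‖ ^ 2) * (1 - ‖x₂‖ ^ 2 - ‖β‖ ^ 2) := by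
    have hx3 : x₃ = x₁ * x₂ - β ^ 2 := by rw [hβ]; ring
    have e1 : ‖s‖ ^ 2 = ‖β‖ ^ 2 * (‖x₁‖ ^ 2 + ‖x₂‖ ^ 2)
        + 2 * (x₁ * x₂ * (starRingEnd ℂ) (β ^ 2)).re := by
      simp only [← Complex.normSq_eq_norm_sq, hs, Complex.normSq_apply, sq β, Complex.add_re,
        Complex.add_im, Complex.mul_re, Complex.mul_im, map_mul, Complex.conj_re, Complex.conj_im]
      ring
    have e2 : ‖x₃‖ ^ 2 = ‖x₁‖ ^ 2 * ‖x₂‖ ^ 2 + (‖β‖ ^ 2) ^ 2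
        - 2 * (x₁ * x₂ * (starRingEnd ℂ) (β ^ 2)).re := by
      rw [hx3, norm_sub_sq_complex, norm_mul, norm_pow, mul_pow]
    nlinarith
  have hP : 0 ≤ 1 - ‖x₁‖ ^ 2 - ‖β‖ ^ 2 := by linarith
  have hQ : 0 ≤ 1 - ‖x₂‖ ^ 2 - ‖β‖ ^ 2 := by linarith
  refine ContinuousLinearMap.opNorm_le_bound _ zero_le_one fun v => ?_
  rw [one_mul]
  refine le_of_sq_le_sq ?_ (norm_nonneg v)
  rw [EuclideanSpace.norm_sq_eq, EuclideanSpace.norm_sq_eq, Fin.sum_univ_two, Fin.sum_univ_two]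
  simp only [Matrix.ofLp_toEuclideanCLM, Matrix.mulVec, dotProduct, Fin.sum_univ_two,
    Matrix.of_apply, Matrix.cons_val_zero, Matrix.cons_val_one, Matrix.cons_val', Matrix.cons_val_fin_one]
  generalize v.ofLp 0 = a
  generalize v.ofLp 1 = b
  have hexp : ‖x₁ * a + β * b‖ ^ 2 + ‖β * a + x₂ * b‖ ^ 2
      = (‖x₁‖ ^ 2 + ‖β‖ ^ 2) * ‖a‖ ^ 2 + (‖x₂‖ ^ 2 + ‖β‖ ^ 2) * ‖b‖ ^ 2
        + 2 * (s * (a * (starRingEnd ℂ) b)).re := by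
    simp only [← Complex.normSq_eq_norm_sq, hs, Complex.normSq_apply, Complex.add_re,
      Complex.add_im, Complex.mul_re, Complex.mul_im, Complex.conj_re, Complex.conj_im]
    ring
  have hcross : (s * (a * (starRingEnd ℂ) b)).re ≤ ‖s‖ * (‖a‖ * ‖b‖) := by
    refine (Complex.re_le_norm _).trans ?_
    rw [norm_mul, norm_mul, RCLike.norm_conj]
  have hs3 : ‖s‖ ≤ √(1 - ‖x₁‖ ^ 2 - ‖β‖ ^ 2) * √(1 - ‖x₂‖ ^ 2 - ‖β‖ ^ 2) := by
    rw [← Real.sqrt_mul hP]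
    exact Real.le_sqrt_of_sq_le hs2
  have hs4 : ‖s‖ * (‖a‖ * ‖b‖)
      ≤ √(1 - ‖x₁‖ ^ 2 - ‖β‖ ^ 2) * √(1 - ‖x₂‖ ^ 2 - ‖β‖ ^ 2) * (‖a‖ * ‖b‖) := by gcongr
  have hamgm := sq_nonneg (√(1 - ‖x₁‖ ^ 2 - ‖β‖ ^ 2) * ‖a‖ - √(1 - ‖x₂‖ ^ 2 - ‖β‖ ^ 2) * ‖b‖)
  rw [sub_sq, mul_pow, mul_pow, Real.sq_sqrt hP, Real.sq_sqrt hQ] at hamgm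
  rw [hexp]
  linarith

/-- The closed tetrablock is the set of points whose polynomial has no zero in the bidisc. -/
theorem mem_Gamma2_iff {x₁ x₂ x₃ : ℂ} :
    ![x₁, x₂, x₃] ∈ Gamma2 ↔ NonvanishingOnBidisc x₁ x₂ x₃ := by
  refine ⟨nonvanishingOnBidisc_of_mem_Gamma2, fun h => ?_⟩
  have hI := h.two_mul_norm_le
  have hII := h.symm.two_mul_norm_le
  have hIII := h.two_mul_norm_det_le
  have hn1 := norm_nonneg (x₂ - (starRingEnd ℂ) x₁ * x₃)
  have hn2 := norm_nonneg (x₁ - (starRingEnd ℂ) x₂ * x₃)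
  exact mem_Gamma2_of_le (by linarith) (by linarith) hIII

/-! ### The domain of the structured singular value of diagonal structure -/

lemma mu_E333_le_one_iff (A : Matrix (Fin 3) (Fin 3) ℂ) :
    mu E333 A ≤ 1 ↔
      ∀ z : Fin 3 → ℂ, (∀ i, ‖z i‖ < 1) → (1 - A * Matrix.diagonal z).det ≠ 0 := by
  classical
  set S : Set ℝ := {r | ∃ X ∈ E333, (1 - A * X).det = 0 ∧ r = opNorm X} with hS
  have hmem : ∀ {r}, r ∈ S ↔ ∃ z : Fin 3 → ℂ, (1 - A * Matrix.diagonal z).det = 0 ∧ r = ‖z‖ := by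
    intro r
    constructor
    · rintro ⟨_, ⟨z, rfl⟩, h0, rfl⟩
      exact ⟨z, h0, opNorm_diagonal z⟩
    · rintro ⟨z, h0, rfl⟩
      exact ⟨_, ⟨z, rfl⟩, h0, (opNorm_diagonal z).symm⟩
  have hne : (∃ X ∈ E333, (1 - A * X).det = 0) ↔ S.Nonempty :=
    ⟨fun ⟨X, hX, h0⟩ => ⟨_, X, hX, h0, rfl⟩, fun ⟨_, X, hX, h0, _⟩ => ⟨X, hX, h0⟩⟩
  have hbdd : BddBelow S := ⟨0, fun r hr => by
    obtain ⟨z, _, rfl⟩ := hmem.1 hr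
    exact norm_nonneg z⟩
  have hrhs : (∀ z : Fin 3 → ℂ, (∀ i, ‖z i‖ < 1) → (1 - A * Matrix.diagonal z).det ≠ 0) ↔
      ∀ r ∈ S, 1 ≤ r := by
    constructor
    · intro h r hr
      obtain ⟨z, h0, rfl⟩ := hmem.1 hr
      by_contra! hlt
      exact h z ((pi_norm_lt_iff one_pos).1 hlt) h0
    · intro h z hz h0
      exact (h ‖z‖ (hmem.2 ⟨z, h0, rfl⟩)).not_gt ((pi_norm_lt_iff one_pos).2 hz)
  rw [hrhs]
  unfold mu
  rw [← hS]
  split_ifs with hex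
  · rw [hne] at hex
    -- As `det (1 - A X) = 1` at `X = 0`, the infimum is positive and `1 / sInf S` is no junk value.
    have hpos : 0 < sInf S := by
      have hcont : Continuous fun z : Fin 3 → ℂ => (1 - A * Matrix.diagonal z).det := by
        fun_prop
      have hev : ∀ᶠ z in nhds (0 : Fin 3 → ℂ), (1 - A * Matrix.diagonal z).det ≠ 0 :=
        hcont.continuousAt.eventually_ne (by simp)
      obtain ⟨ε, hε, hball⟩ := Metric.eventually_nhds_iff.1 hev
      refine hε.trans_le (le_csInf hex fun r hr => ?_)
      obtain ⟨z, h0, rfl⟩ := hmem.1 hr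
      by_contra! hlt
      exact hball (by simpa using hlt) h0
    rw [div_le_one hpos]
    exact ⟨fun h r hr => h.trans (csInf_le hbdd hr), le_csInf hex⟩
  · rw [hne, Set.not_nonempty_iff_eq_empty] at hex
    simp [hex]

lemma det_one_sub_mul_diagonal (A : Matrix (Fin 3) (Fin 3) ℂ) (z : Fin 3 → ℂ) :
    (1 - A * Matrix.diagonal z).det =
      1 - A 0 0 * z 0 - A 1 1 * z 1 + (A 0 0 * A 1 1 - A 0 1 * A 1 0) * (z 0 * z 1) -
        A 2 2 * z 2 + (A 0 0 * A 2 2 - A 0 2 * A 2 0) * (z 0 * z 2) +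
        (A 1 1 * A 2 2 - A 1 2 * A 2 1) * (z 1 * z 2) - A.det * (z 0 * z 1 * z 2) := by
  rw [Matrix.det_fin_three, Matrix.det_fin_three]
  simp only [Matrix.sub_apply, Matrix.mul_diagonal, Matrix.one_apply]
  simp
  ring

theorem mem_Gamma3_iff {x₁ x₆ x₇ : ℂ} :
    ![x₁, 0, 0, 0, 0, x₆, x₇] ∈ Gamma3 ↔ ![x₁, x₆, x₇] ∈ Gamma2 := by
  rw [mem_Gamma2_iff]
  constructor
  · rintro ⟨A, hA, hx⟩ z w hz hw
    rw [mu_E333_le_one_iff] at hA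
    -- The substitution `w = - z₂ z₃` links the two polynomials.
    obtain ⟨ζ, hζ⟩ := IsAlgClosed.exists_pow_nat_eq (-w) (n := 2) two_pos
    have hζ1 : ‖ζ‖ < 1 := by
      have : ‖ζ‖ ^ 2 < 1 := by rw [← norm_pow, hζ, norm_neg]; exact hw
      exact (sq_lt_one_iff₀ (norm_nonneg _)).1 this
    have h := hA ![z, ζ, ζ] (by simp [Fin.forall_fin_succ, hz, hζ1])
    rw [det_one_sub_mul_diagonal] at h
    have h0 := congrFun hx 0
    have h1 := congrFun hx 1
    have h2 := congrFun hx 2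
    have h3 := congrFun hx 3
    have h4 := congrFun hx 4
    have h5 := congrFun hx 5
    have h6 := congrFun hx 6
    simp at h0 h1 h2 h3 h4 h5 h6
    rw [← h2, ← h4, ← h5, ← h6, ← h0, ← h1, ← h3] at h
    simp at h
    have hw' : w = -(ζ * ζ) := by rw [← sq, hζ, neg_neg]
    rw [hw']
    convert h using 1
    ring
  · intro h
    refine ⟨!![x₁, x₇ - x₁ * x₆, 0; 0, 0, 1; 1, -x₆, 0], ?_, ?_⟩
    · rw [mu_E333_le_one_iff]
      intro z hz
      have hw : ‖-(z 1 * z 2)‖ < 1 := by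
        rw [norm_neg, norm_mul]
        exact mul_lt_one_of_nonneg_of_lt_one_left (norm_nonneg _) (hz 1) (hz 2).le
      intro h0
      refine h (z 0) (-(z 1 * z 2)) (hz 0) hw ?_
      rw [det_one_sub_mul_diagonal, Matrix.det_fin_three] at h0
      simp at h0
      linear_combination h0
    · rw [Matrix.det_fin_three]
      simp

lemma norm_zero_le_of_mem_Gamma3 {x : Fin 7 → ℂ} (h : x ∈ Gamma3) : ‖x 0‖ ≤ 1 := by
  obtain ⟨A, hA, rfl⟩ := h
  rw [mu_E333_le_one_iff] at hA
  by_contra! hlt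
  simp only [Matrix.cons_val_zero] at hlt
  have hne : A 0 0 ≠ 0 := norm_pos_iff.1 (one_pos.trans hlt)
  refine hA ![(A 0 0)⁻¹, 0, 0] ?_ ?_
  · have := inv_lt_one_of_one_lt₀ hlt
    simpa [Fin.forall_fin_succ] using this
  · rw [det_one_sub_mul_diagonal]
    simp [hne]

/-! ### The distinguished boundaries -/

lemma mem_K3_of_mem_K2 {x₁ x₆ x₇ : ℂ} (h : ![x₁, x₆, x₇] ∈ K2) :
    ![x₁, 0, 0, 0, 0, x₆, x₇] ∈ K3 := by
  obtain ⟨hG, h1, h2⟩ := h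
  exact ⟨mem_Gamma3_iff.2 hG, h1, by simp, by simp, h2⟩

/-- The coordinates `x₁, x₆, x₇` of every point of `K` form a point of the distinguished boundary of
the tetrablock, although the other coordinates need not vanish: `x₁ = conj x₆ * x₇` and `|x₇| = 1`
reduce membership in the tetrablock to `|x₁| ≤ 1`. -/
lemma mem_K2_of_mem_K3 {x : Fin 7 → ℂ} (h : x ∈ K3) : ![x 0, x 5, x 6] ∈ K2 := by
  obtain ⟨hG, h1, -, -, h2⟩ := h
  have h01 := norm_zero_le_of_mem_Gamma3 hG
  have hn : ‖x 0‖ = ‖x 5‖ := by rw [h1, norm_mul, norm_star, h2, mul_one]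
  have hdet : ‖x 0 * x 5 - x 6‖ = 1 - ‖x 5‖ ^ 2 := by
    have : x 0 * x 5 - x 6 = -((1 - ‖x 5‖ ^ 2 : ℝ) * x 6) := by
      have hc : star (x 5) * x 5 = (‖x 5‖ : ℂ) ^ 2 := Complex.conj_mul' _
      rw [h1]
      push_cast
      rw [← hc]
      ring
    rw [this, norm_neg, norm_mul, h2, mul_one, Complex.norm_real, Real.norm_of_nonneg]
    nlinarith [norm_nonneg (x 5)]
  refine ⟨mem_Gamma2_of_le ?_ ?_ ?_, h1, h2⟩
  · rw [hdet, hn]; linarith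
  · rw [hdet]; linarith
  · rw [hdet, hn, h2]; linarith

/-! ### Unitaries and isometries -/

section Unitaries

variable {K : Type u} [NormedAddCommGroup K] [InnerProductSpace ℂ K] [CompleteSpace K]

/-- A character annihilates the zero entries, so the joint spectrum of the padded tuple consists of
padded points. -/
lemma IsTetrablockUnitary.isGamma3Unitary {N : Fin 3 → K →L[ℂ] K} (h : IsTetrablockUnitary N) :
    IsGamma3Unitary ![N 0, 0, 0, 0, 0, N 1, N 2] := by
  obtain ⟨hc, hn, hs⟩ := h
  obtain ⟨B, hB, hBc, hNB⟩ := exists_comm_starSubalgebra hc hn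
  have hmem : ∀ i, ![N 0, 0, 0, 0, 0, N 1, N 2] i ∈ B := by
    simp [Fin.forall_fin_succ, hNB]
  refine ⟨fun i j => hBc _ (hmem i) _ (hmem j), ?_, fun z hz => ?_⟩
  · simp [Fin.forall_fin_succ, hn, IsStarNormal.zero]
  · obtain ⟨χ, hχ⟩ := (mem_taylorSpectrum_iff B hB hBc hmem z).1 hz
    have hz0 : z = ![z 0, 0, 0, 0, 0, z 5, z 6] := by
      have h0 : χ ⟨0, B.zero_mem⟩ = 0 := map_zero χ
      funext i
      fin_cases i
      · rfl
      · exact (hχ 1).symm.trans h0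
      · exact (hχ 2).symm.trans h0
      · exact (hχ 3).symm.trans h0
      · exact (hχ 4).symm.trans h0
      · rfl
      · rfl
    rw [hz0]
    refine mem_K3_of_mem_K2 (hs ((mem_taylorSpectrum_iff B hB hBc hNB _).2 ⟨χ, ?_⟩))
    simp only [Fin.forall_fin_succ, IsEmpty.forall_iff, and_true]
    exact ⟨hχ 0, hχ 5, hχ 6⟩

/-- Every point of the joint spectrum of `(N₁, N₆, N₇)` is the projection of a point of the joint
spectrum of `N`, namely of the values at `N` of the same character. -/
lemma IsGamma3Unitary.isTetrablockUnitary {N : Fin 7 → K →L[ℂ] K} (h : IsGamma3Unitary N) :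
    IsTetrablockUnitary ![N 0, N 5, N 6] := by
  obtain ⟨hc, hn, hs⟩ := h
  obtain ⟨B, hB, hBc, hNB⟩ := exists_comm_starSubalgebra hc hn
  have hmem : ∀ i, ![N 0, N 5, N 6] i ∈ B := by
    simp [Fin.forall_fin_succ, hNB]
  refine ⟨fun i j => hBc _ (hmem i) _ (hmem j), ?_, fun z hz => ?_⟩
  · simp [Fin.forall_fin_succ, hn]
  · obtain ⟨χ, hχ⟩ := (mem_taylorSpectrum_iff B hB hBc hmem z).1 hz
    have hK := mem_K2_of_mem_K3 (hs ((mem_taylorSpectrum_iff B hB hBc hNB _).2 ⟨χ, fun _ => rfl⟩))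
    convert hK using 1
    funext i
    fin_cases i
    · exact (hχ 0).symm
    · exact (hχ 1).symm
    · exact (hχ 2).symm

end Unitaries

section Isometries

variable {H : Type u} [NormedAddCommGroup H] [InnerProductSpace ℂ H]

lemma isTetrablockIsometry_iff {T₁ T₆ T₇ : H →L[ℂ] H} (h16 : Commute T₁ T₆) (h17 : Commute T₁ T₇)
    (h67 : Commute T₆ T₇) :
    IsTetrablockIsometry ![T₁, T₆, T₇] ↔ IsGamma3Isometry ![T₁, 0, 0, 0, 0, T₆, T₇] := by
  constructor
  · rintro ⟨-, K, _, _, _, N, J, hN, hJ⟩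
    refine ⟨?_, K, _, _, _, _, J, hN.isGamma3Unitary, ?_⟩
    · simp [Fin.forall_fin_succ, h16, h17, h67, h16.symm, h17.symm, h67.symm]
    · have h0 := hJ 0
      have h1 := hJ 1
      have h2 := hJ 2
      simp only [Matrix.cons_val] at h0 h1 h2
      simp [Fin.forall_fin_succ, h0, h1, h2]
  · rintro ⟨-, K, _, _, _, N, J, hN, hJ⟩
    refine ⟨?_, K, _, _, _, _, J, hN.isTetrablockUnitary, ?_⟩
    · simp [Fin.forall_fin_succ, h16, h17, h67, h16.symm, h17.symm, h67.symm]
    · have h0 := hJ 0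
      have h5 := hJ 5
      have h6 := hJ 6
      simp only [Matrix.cons_val] at h0 h5 h6
      simp [Fin.forall_fin_succ, h0, h5, h6]

end Isometries

end Tetrablock

theorem mainTheorem9 :
    (∀ x₁ x₆ x₇ : ℂ,
      ![x₁, 0, 0, 0, 0, x₆, x₇] ∈ Tetrablock.Gamma3 ↔ ![x₁, x₆, x₇] ∈ Tetrablock.Gamma2) ∧
    (∀ (H : Type u) [NormedAddCommGroup H] [InnerProductSpace ℂ H] [CompleteSpace H]
      (T₁ T₆ T₇ : H →L[ℂ] H), Commute T₁ T₆ → Commute T₁ T₇ → Commute T₆ T₇ →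
      (Tetrablock.IsTetrablockIsometry ![T₁, T₆, T₇] ↔
        Tetrablock.IsGamma3Isometry ![T₁, 0, 0, 0, 0, T₆, T₇])) := by
  exact ⟨fun _ _ _ => Tetrablock.mem_Gamma3_iff,
    fun _ _ _ _ _ _ _ h16 h17 h67 => Tetrablock.isTetrablockIsometry_iff h16 h17 h67⟩
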